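/- Let $k$ be a field, let $rk\ge 1$, and let $p,q\ge 1$ be coprime integers. Put $\Gamma=\mathbb{Z}_+p+\mathbb{Z}_+q$, $\tilde\Gamma=rk\cdot\Gamma$, $\mathcal{O}=k[[z]]$, $\mathcal{R}=k[[z^p,z^q]]$, and $\tilde{\mathcal{O}}=\mathcal{O}[z^{1/rk}]=k[[z^{1/rk}]]$, a free $\mathcal{O}$-module of rank $rk$, with the valuation $\upsilon(z^{j/rk})=j$, so that $\upsilon(\mathcal{R}\setminus 0)=\tilde\Gamma$. An $\mathcal{R}$-submodule $\mathcal{M}\subset\tilde{\mathcal{O}}$ is called standard if it generates $\tilde{\mathcal{O}}$ over $\mathcal{O}$; its valuation set is $\upsilon(\mathcal{M}\setminus 0)$. A standard rank-$rk$ module over $\tilde\Gamma$ is a subset $\Delta\subset\mathbb{Z}_+$ with $\tilde\Gamma+\Delta\subset\Delta$ and $0,1,\dots,rk-1\in\Delta$. For such $\Delta$ and $0\le i\le rk-1$, let $\Delta^{(i)}=\{x\in\mathbb{Z}_+ : rk\cdot x+i\in\Delta\}$. The $p$-basis of $\Delta^{(i)}$ is the unique $p$-tuple $(a_{i,0},\dots,a_{i,p-1})$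 such that $a_{i,j}\equiv jq \pmod p$ and $\Delta^{(i)}=\bigsqcup_{j=0}^{p-1}(a_{i,j}+p\,\mathbb{Z}_+)$. For $b\in\mathbb{Z}_+$ let $\gamma_\Delta(b)=|\{n\in\mathbb{Z}_+ : n\ge b,\ n\notin\Delta\}|$. The cell $\mathcal{J}_{\mathcal{R},rk}(\Delta)$ is the set of all standard $\mathcal{R}$-submodules $\mathcal{M}\subset\tilde{\mathcal{O}}$ with valuation set $\Delta$. All such $\mathcal{M}$ contain $z^{\mathsf c}\tilde{\mathcal{O}}$, where $\mathsf c$ is the conductor of $\Gamma$, and the cell is regarded as the locally closed subscheme of the Grassmannian of the finite-dimensional $k$-space $\tilde{\mathcal{O}}/z^{\mathsf c}\tilde{\mathcal{O}}$ defined by $\mathcal{R}$-invariance and by the jump conditions that describe $\Delta$. In terms of its functor of points: for a commutative $k$-algebra $A$, the $A$-points are the $A[[z^p,z^q]]$-submodules $M\subset A[[z^{1/rk}]]$ that generate $A[[z^{1/rk}]]$ over $A[[z]]$ and for which, for every $d\in\mathbb{Z}_+$, the set of coefficients of $z^{d/rk}$ of the elements of $M\cap z^{d/rk}A[[z^{1/rk}]]$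 is $A$ if $d\in\Delta$ and $0$ if $d\notin\Delta$; a homomorphism $A\to B$ sends $M$ to the $B[[z^p,z^q]]$-submodule of $B[[z^{1/rk}]]$ generated by the image of $M$. For a field $A=K$ these are exactly the standard submodules with valuation set $\Delta$. Theorem. For every standard rank-$rk$ module $\Delta$ over $\tilde\Gamma$, the cell $\mathcal{J}_{\mathcal{R},rk}(\Delta)$ is biregular (isomorphic over $k$) to the affine space $\mathbb{A}_k^{\sum_{i=0}^{rk-1}N_i}$, where $$N_i=\sum_{j=0}^{p-1}\bigl(\gamma_\Delta(rk\cdot a_{i,j}+i)-\gamma_\Delta(rk\cdot a_{i,j}+i+rk\cdot q)\bigr).$$ Equivalently, with $N=\sum_{i}N_i$, there are bijections, natural in the commutative $k$-algebra $A$, between the $A$-points of the cell and $A^{N}$. -/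

import Mathlib

open PowerSeries

universe u

namespace TorusCell

/-- The semigroup `rk·(ℤ₊ p + ℤ₊ q)`: the values of the nonzero elements of `k[[z^p, z^q]]` for the
valuation with `z^(1/rk) ↦ 1`. -/
def semigroup (rk p q : ℕ) : AddSubmonoid ℕ := AddSubmonoid.closure {rk * p, rk * q}

/-- Throughout, the ring `𝒪[z^(1/rk)]` over `A` is `A⟦X⟧`, with `X = z^(1/rk)` and `z = X ^ rk`.
`seriesRing A S` is the subring of the power series whose exponents lie in the submonoid `S`. -/
def seriesRing (A : Type u) [CommRing A] (S : AddSubmonoid ℕ) : Subalgebra A A⟦X⟧ where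
  carrier := {f | ∀ n, coeff n f ≠ 0 → n ∈ S}
  mul_mem' := by
    intro f g hf hg n hn
    rw [coeff_mul] at hn
    obtain ⟨x, hx, hne⟩ := Finset.exists_ne_zero_of_sum_ne_zero hn
    rw [← Finset.HasAntidiagonal.mem_antidiagonal.mp hx]
    exact S.add_mem (hf _ (left_ne_zero_of_mul hne)) (hg _ (right_ne_zero_of_mul hne))
  add_mem' := by
    intro f g hf hg n hn
    by_cases h : coeff n f = 0
    · exact hg n (by simpa [h] using hn)
    · exact hf n h
  algebraMap_mem' := by
    intro r n hn
    have h0 : n = 0 := by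
      by_contra h
      exact hn (by simp [coeff_C, h])
    exact h0 ▸ S.zero_mem

/-- `A[[z]]`, inside `A⟦X⟧` with `z = X ^ rk`. -/
abbrev baseRing (A : Type u) [CommRing A] (rk : ℕ) : Subalgebra A A⟦X⟧ :=
  seriesRing A (AddSubmonoid.multiples rk)

/-- `A[[z^p, z^q]]`, inside `A⟦X⟧` with `z = X ^ rk`; see `mem_torusRing_iff`. -/
abbrev torusRing (A : Type u) [CommRing A] (rk p q : ℕ) : Subalgebra A A⟦X⟧ :=
  seriesRing A (semigroup rk p q)

/-- `Δ ⊆ ℕ` is a standard rank-`rk` module over `rk·(ℤ₊ p + ℤ₊ q)`. -/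
structure IsStandardSet (rk p q : ℕ) (Δ : Set ℕ) : Prop where
  add_mem : ∀ s ∈ semigroup rk p q, ∀ d ∈ Δ, s + d ∈ Δ
  lt_mem : ∀ i < rk, i ∈ Δ

/-- The component `Δ⁽ⁱ⁾ = {(x - i)/rk ∣ x ∈ Δ, x ≡ i mod rk}`. -/
def component (rk : ℕ) (Δ : Set ℕ) (i : ℕ) : Set ℕ := {x | rk * x + i ∈ Δ}

/-- The element `a_{i,j}` of the `p`-basis: the least element of `Δ⁽ⁱ⁾` congruent to `j q` mod `p`;
see `pBasis_modEq` and `component_eq_iUnion`. -/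
noncomputable def pBasis (rk p q : ℕ) (Δ : Set ℕ) (i j : ℕ) : ℕ :=
  sInf {x | x ∈ component rk Δ i ∧ x ≡ j * q [MOD p]}

/-- The gap counting function `γ_Δ(b) = |[b, ∞) ∖ Δ|`. -/
noncomputable def gapCount (Δ : Set ℕ) (b : ℕ) : ℕ := {n | b ≤ n ∧ n ∉ Δ}.ncard

/-- The exponent `N_i`. -/
noncomputable def exponent (rk p q : ℕ) (Δ : Set ℕ) (i : ℕ) : ℤ :=
  ∑ j ∈ Finset.range p,
    ((gapCount Δ (rk * pBasis rk p q Δ i j + i) : ℤ)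
      - (gapCount Δ (rk * pBasis rk p q Δ i j + i + rk * q) : ℤ))

/-- A submodule is standard if it generates the free rank-`rk` module `A⟦X⟧` over `A[[z]]`. -/
def IsStandard {A : Type u} [CommRing A] {rk p q : ℕ}
    (M : Submodule (torusRing A rk p q) A⟦X⟧) : Prop :=
  Submodule.span (baseRing A rk) (M : Set A⟦X⟧) = ⊤

/-- The set of valuations `υ(M)` of the nonzero elements of `M`. -/
def valuationSet {A : Type u} [CommRing A] {rk p q : ℕ}
    (M : Submodule (torusRing A rk p q) A⟦X⟧) : Set ℕ :=
  {d | ∃ f ∈ M, f.order = d}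

/-- The `A`-points of the cell of `Δ`: the standard `A[[z^p, z^q]]`-submodules `M` of
`A[[z]][z^(1/rk)] = A⟦X⟧` such that `M ∩ X^d A⟦X⟧` has in `X^d A⟦X⟧ / X^(d+1) A⟦X⟧ ≅ A` the image
`A` if `d ∈ Δ` and the image `0` if `d ∉ Δ`. If `A` is a field, the latter says exactly that
`υ(M) = Δ` (`mem_cell_iff_of_field`). Every such `M` contains `z^c A⟦X⟧` for the conductor `c`
(`mem_of_mem_cell`), so that `M` is the same as a submodule of `A⟦X⟧ / z^c A⟦X⟧`: this functor of
`A` is the functor of points of the subvariety of the Grassmannian of `k⟦X⟧ / z^c k⟦X⟧` given by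
invariance and by the jump conditions of the Schubert cell of `Δ`. -/
def cell (A : Type u) [CommRing A] (rk p q : ℕ) (Δ : Set ℕ) :
    Set (Submodule (torusRing A rk p q) A⟦X⟧) :=
  {M | IsStandard M ∧
    (∀ d ∈ Δ, ∃ f ∈ M, (∀ n < d, coeff n f = 0) ∧ coeff d f = 1) ∧
    (∀ d ∉ Δ, ∀ f ∈ M, (∀ n < d, coeff n f = 0) → coeff d f = 0)}

/-- The base change of a module along `φ : A → B`: the `B[[z^p, z^q]]`-submodule of `B⟦X⟧` generated
by the image of `M`. -/
noncomputable def baseChange {A B : Type u} [CommRing A] [CommRing B] (φ : A →+* B) {rk p q : ℕ}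
    (M : Submodule (torusRing A rk p q) A⟦X⟧) : Submodule (torusRing B rk p q) B⟦X⟧ :=
  Submodule.span (torusRing B rk p q) (PowerSeries.map φ '' (M : Set A⟦X⟧))

theorem mem_semigroup_iff (rk p q n : ℕ) :
    n ∈ semigroup rk p q ↔ ∃ a b : ℕ, a * (rk * p) + b * (rk * q) = n := by
  simp [semigroup, AddSubmonoid.mem_closure_pair]

/-- `torusRing A rk p q` consists of the series `∑ g_{a,b} (z^p)^a (z^q)^b` in `z^p` and `z^q`. -/
theorem mem_torusRing_iff {A : Type u} [CommRing A] {rk p q : ℕ} (hrk : 0 < rk) (hp : 0 < p)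
    (hq : 0 < q) (f : A⟦X⟧) :
    f ∈ torusRing A rk p q ↔ ∃ g : MvPowerSeries (Fin 2) A,
      f = g.subst (![X ^ (rk * p), X ^ (rk * q)] : Fin 2 → A⟦X⟧) := by
  have hs : MvPowerSeries.HasSubst (![X ^ (rk * p), X ^ (rk * q)] : Fin 2 → A⟦X⟧) := by
    apply MvPowerSeries.hasSubst_of_constantCoeff_zero
    intro s
    change PowerSeries.constantCoeff _ = 0
    fin_cases s
    · simp [hrk.ne', hp.ne']
    · simp [hrk.ne', hq.ne']
  have hcoeff : ∀ (g : MvPowerSeries (Fin 2) A) (n : ℕ),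
      coeff n (g.subst (![X ^ (rk * p), X ^ (rk * q)] : Fin 2 → A⟦X⟧)) =
        ∑ᶠ d : Fin 2 →₀ ℕ, if n = d 0 * (rk * p) + d 1 * (rk * q)
          then MvPowerSeries.coeff d g else 0 := by
    intro g n
    rw [PowerSeries.coeff, MvPowerSeries.coeff_subst hs]
    refine finsum_congr fun d => ?_
    have h : (d.prod fun s e => (![X ^ (rk * p), X ^ (rk * q)] : Fin 2 → A⟦X⟧) s ^ e) =
        X ^ (d 0 * (rk * p) + d 1 * (rk * q)) := by
      rw [Finsupp.prod_fintype _ _ (by simp), Fin.prod_univ_two]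
      simp [← pow_mul, pow_add, mul_comm]
    rw [h]
    change _ • PowerSeries.coeff n _ = _
    rw [coeff_X_pow]
    simp
  constructor
  · intro hf
    have hdec : ∀ n, ∃ d : Fin 2 →₀ ℕ, coeff n f ≠ 0 → n = d 0 * (rk * p) + d 1 * (rk * q) := by
      intro n
      by_cases hn : coeff n f = 0
      · exact ⟨0, fun h => absurd hn h⟩
      · obtain ⟨a, b, h⟩ := (mem_semigroup_iff _ _ _ _).1 (hf n hn)
        exact ⟨Finsupp.equivFunOnFinite.symm ![a, b], fun _ => by simp [h]⟩
    choose D hD using hdec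
    classical
    let g : MvPowerSeries (Fin 2) A := fun d => if D (d 0 * (rk * p) + d 1 * (rk * q)) = d
      then coeff (d 0 * (rk * p) + d 1 * (rk * q)) f else 0
    have hg : ∀ d, MvPowerSeries.coeff d g = if D (d 0 * (rk * p) + d 1 * (rk * q)) = d
      then coeff (d 0 * (rk * p) + d 1 * (rk * q)) f else 0 := fun _ => rfl
    refine ⟨g, ?_⟩
    ext n
    rw [hcoeff, finsum_eq_single _ (D n)]
    · by_cases hn : coeff n f = 0
      · rw [hn]
        split_ifs with h
        · rw [hg, ← h]
          simp [hn]
        · rfl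
      · rw [if_pos (hD n hn)]
        rw [hg, ← hD n hn]
        simp
    · intro d hd
      split_ifs with h
      · rw [hg, ← h, if_neg hd.symm]
      · rfl
  · rintro ⟨g, rfl⟩ n hn
    rw [hcoeff] at hn
    obtain ⟨d, hd⟩ : ∃ d : Fin 2 →₀ ℕ, (if n = d 0 * (rk * p) + d 1 * (rk * q)
        then MvPowerSeries.coeff d g else 0) ≠ 0 := by
      by_contra! hall
      exact hn (by simp only [hall, finsum_zero])
    by_cases h : n = d 0 * (rk * p) + d 1 * (rk * q)
    · exact (mem_semigroup_iff _ _ _ _).2 ⟨d 0, d 1, h.symm⟩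
    · simp [h] at hd

theorem pBasis_mem {rk p q : ℕ} {Δ : Set ℕ}
    (hΔ : IsStandardSet rk p q Δ) {i : ℕ} (hi : i < rk) (j : ℕ) :
    pBasis rk p q Δ i j ∈ {x | x ∈ component rk Δ i ∧ x ≡ j * q [MOD p]} := by
  apply Nat.sInf_mem
  refine ⟨j * q, ?_, Nat.ModEq.refl _⟩
  have h := hΔ.add_mem (rk * (j * q))
    ((mem_semigroup_iff _ _ _ _).2 ⟨0, j, by ring⟩) i (hΔ.lt_mem i hi)
  exact h

/-- `a_{i,j} ≡ j q` mod `p`. -/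
theorem pBasis_modEq {rk p q : ℕ} {Δ : Set ℕ}
    (hΔ : IsStandardSet rk p q Δ) {i : ℕ} (hi : i < rk) (j : ℕ) :
    pBasis rk p q Δ i j ≡ j * q [MOD p] := (pBasis_mem hΔ hi j).2

/-- `Δ⁽ⁱ⁾` is the union of the progressions `a_{i,j} + p ℕ`, `0 ≤ j ≤ p - 1`. -/
theorem component_eq_iUnion {rk p q : ℕ} (hp : 0 < p) (hpq : p.Coprime q)
    {Δ : Set ℕ} (hΔ : IsStandardSet rk p q Δ) {i : ℕ} (hi : i < rk) :
    component rk Δ i = ⋃ j ∈ Finset.range p, {x | ∃ n, x = pBasis rk p q Δ i j + p * n} := by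
  ext x
  simp only [Set.mem_iUnion, Finset.mem_range, Set.mem_ofPred_eq, exists_prop]
  constructor
  · intro hx
    obtain ⟨y, hy⟩ := Nat.exists_mul_mod_eq_of_coprime x hpq.symm hp.ne'
    have hxy : x ≡ y % p * q [MOD p] := by
      have h1 : y % p * q ≡ y * q [MOD p] := (Nat.mod_modEq y p).mul_right q
      have h2 : q * y ≡ x [MOD p] := hy.2
      rw [mul_comm] at h2
      exact (h1.trans h2).symm
    have hle : pBasis rk p q Δ i (y % p) ≤ x := Nat.sInf_le ⟨hx, hxy⟩
    have hmod := (pBasis_modEq hΔ hi (y % p)).trans hxy.symm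
    obtain ⟨n, hn⟩ := (Nat.modEq_iff_dvd' hle).1 hmod
    exact ⟨y % p, Nat.mod_lt _ hp, n, by omega⟩
  · rintro ⟨j, -, n, rfl⟩
    have h := hΔ.add_mem (rk * (p * n))
      ((mem_semigroup_iff _ _ _ _).2 ⟨n, 0, by ring⟩) _ (pBasis_mem hΔ hi j).1
    change rk * _ + i ∈ Δ
    convert h using 1
    ring

theorem mem_valuationSet_iff_of_field {K : Type u} [Field K] {rk p q : ℕ}
    (M : Submodule (torusRing K rk p q) K⟦X⟧) (d : ℕ) :
    d ∈ valuationSet M ↔ ∃ f ∈ M, (∀ n < d, coeff n f = 0) ∧ coeff d f ≠ 0 := by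
  simp only [valuationSet, Set.mem_ofPred_eq, PowerSeries.order_eq_nat]
  exact exists_congr fun f => and_congr_right fun _ => and_comm

/-- Over a field `K`, the points of the cell are the standard modules `M` with `υ(M) = Δ`. -/
theorem mem_cell_iff_of_field {K : Type u} [Field K] {rk p q : ℕ} {Δ : Set ℕ}
    (M : Submodule (torusRing K rk p q) K⟦X⟧) :
    M ∈ cell K rk p q Δ ↔ IsStandard M ∧ valuationSet M = Δ := by
  refine and_congr_right fun _ => ⟨?_, ?_⟩
  · rintro ⟨h1, h2⟩
    ext d
    rw [mem_valuationSet_iff_of_field]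
    constructor
    · rintro ⟨f, hf, h0, hd⟩
      by_contra hdΔ
      exact hd (h2 d hdΔ f hf h0)
    · intro hd
      obtain ⟨f, hf, h0, h⟩ := h1 d hd
      exact ⟨f, hf, h0, by simp [h]⟩
  · rintro rfl
    refine ⟨fun d hd => ?_, fun d hd f hf h0 => ?_⟩
    · obtain ⟨f, hf, h0, h⟩ := (mem_valuationSet_iff_of_field M d).1 hd
      have hc : C (coeff d f)⁻¹ ∈ torusRing K rk p q :=
        (torusRing K rk p q).algebraMap_mem (coeff d f)⁻¹
      refine ⟨C (coeff d f)⁻¹ * f, M.smul_mem ⟨_, hc⟩ hf, fun n hn => ?_, ?_⟩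
      · simp [h0 n hn]
      · simp [h]
    · by_contra h
      exact hd ((mem_valuationSet_iff_of_field M d).2 ⟨f, hf, h0, h⟩)

/-- If all integers `n ≥ c` lie in `ℤ₊ p + ℤ₊ q`, then `z^c A⟦X⟧ ⊆ M` for every standard `M`. -/
theorem mem_of_mem_cell {A : Type u} [CommRing A] {rk p q : ℕ} {Δ : Set ℕ}
    {M : Submodule (torusRing A rk p q) A⟦X⟧} (hM : M ∈ cell A rk p q Δ) {c : ℕ}
    (hc : ∀ n, c ≤ n → rk * n ∈ semigroup rk p q) (f : A⟦X⟧) :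
    X ^ (rk * c) * f ∈ M := by
  have hf : f ∈ Submodule.span (baseRing A rk) (M : Set A⟦X⟧) := by
    rw [hM.1]
    trivial
  suffices h : ∀ g ∈ baseRing A rk, X ^ (rk * c) * (g * f) ∈ M by
    simpa using h 1 (one_mem _)
  induction hf using Submodule.span_induction with
  | zero => intro g _; simp
  | add x y _ _ hx hy =>
    intro g hg
    rw [mul_add, mul_add]
    exact M.add_mem (hx g hg) (hy g hg)
  | smul a x _ hx =>
    intro g hg
    have h := hx (g * a) (mul_mem hg a.2)
    rwa [mul_assoc] at h
  | mem x hx =>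
    intro g hg
    have hr : X ^ (rk * c) * g ∈ torusRing A rk p q := by
      intro n hn
      rw [coeff_X_pow_mul'] at hn
      split_ifs at hn with hle
      · obtain ⟨m, hm⟩ := hg _ hn
        have hm' : m * rk = n - rk * c := by simpa using hm
        have : n = rk * (c + m) := by
          rw [mul_add, mul_comm rk m]
          omega
        rw [this]
        exact hc _ (Nat.le_add_right _ _)
      · exact absurd rfl hn
    have h := M.smul_mem ⟨_, hr⟩ hx
    rw [← mul_assoc]
    exact h

end TorusCell

/-! For each residue class `s` mod `rk * p` let `b_s` be the least element of `Δ` in that class. A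
point `M` of the cell contains a unique reduced series `X ^ b_s * ∑ l s g * X ^ g`: its coefficient
at `b_s` is 1 and those at the other elements of `Δ` are 0. Translating the same coefficients to
every exponent `d` in the class of `s` gives a unitriangular family `G d`, and `M` is exactly the
set of series whose expansion along `G` is supported on `Δ` (`mem_iff_mem_expansionSubmodule`).

Multiplication by `z^p` only shifts the family, so invariance reduces to expanding `z^q * G b_s`
with no index outside `Δ`. If `m s` denotes its coefficients, degree `g` reads `l s g = l (s + rk*q)
g + m s g + (terms of lower degree)`. Where `b_s + rk*q + g ∈ Δ`, the unknown `m s g` absorbs the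
equation, and `l s g` is free if `b_s + g ∉ Δ` and zero otherwise. Elsewhere `m s g = 0`, so `l s g`
is determined by its value at the next class of the orbit `s ↦ s + rk*q`. Every orbit leaves the
second case (`exists_classMin_add_mem`), so the system is solvable for arbitrary free values
(`exists_isSyzygy`), and uniquely (`IsSyzygy.ext`).

This gives `bijective_freeCoeff`. Reduced series are compatible with ring maps
(`generatorCoeff_baseChange`), hence naturality. For fixed `s` the free positions are the gaps from
`b_s` on that enter `Δ` after a shift by `rk*q`; their number is a difference of two gap counts, and
the `b_s` are the numbers `rk * a_{i,j} + i` (`sum_exponent_eq`). -/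

namespace TorusCell

/-! ### Expansions along unitriangular families of power series -/

section Expansion

variable {A : Type u} [CommRing A]

/-- The `n`-th series of the family `G` starts with `X ^ n`. -/
structure IsUnitriangular (G : ℕ → A⟦X⟧) : Prop where
  coeff_of_lt : ∀ d n, n < d → coeff n (G d) = 0
  coeff_self : ∀ d, coeff d (G d) = 1

/-- The coefficients `c n` of the expansion `h = ∑ c n * G n` along a unitriangular family `G`. -/
noncomputable def expansionCoeff (G : ℕ → A⟦X⟧) : ℕ → A⟦X⟧ →ₗ[A] A
  | n => coeff n - ∑ i : Fin n, coeff n (G i) • expansionCoeff G i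

theorem expansionCoeff_apply (G : ℕ → A⟦X⟧) (n : ℕ) (h : A⟦X⟧) :
    expansionCoeff G n h =
      coeff n h - ∑ i ∈ Finset.range n, expansionCoeff G i h * coeff n (G i) := by
  rw [expansionCoeff, ← Fin.sum_univ_eq_sum_range (fun i => expansionCoeff G i h * coeff n (G i))]
  simp [mul_comm]

theorem coeff_eq_sum_expansionCoeff {G : ℕ → A⟦X⟧} (hG : IsUnitriangular G) (n : ℕ) (h : A⟦X⟧) :
    coeff n h = ∑ i ∈ Finset.range (n + 1), expansionCoeff G i h * coeff n (G i) := by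
  rw [Finset.sum_range_succ, hG.coeff_self, expansionCoeff_apply G n h]
  ring

theorem expansionCoeff_eq {G : ℕ → A⟦X⟧} (hG : IsUnitriangular G) {h : A⟦X⟧} {c : ℕ → A}
    (hc : ∀ n, coeff n h = ∑ i ∈ Finset.range (n + 1), c i * coeff n (G i)) (n : ℕ) :
    expansionCoeff G n h = c n := by
  induction n using Nat.strong_induction_on with
  | _ n ih =>
    have h1 : ∀ i ∈ Finset.range n,
        expansionCoeff G i h * coeff n (G i) = c i * coeff n (G i) := fun i hi => by
      rw [ih i (Finset.mem_range.1 hi)]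
    rw [expansionCoeff_apply, hc, Finset.sum_range_succ, hG.coeff_self, Finset.sum_congr rfl h1]
    ring

theorem expansionCoeff_eq_zero_of_coeff {G : ℕ → A⟦X⟧} {h : A⟦X⟧} {n : ℕ}
    (h0 : ∀ m ≤ n, coeff m h = 0) : expansionCoeff G n h = 0 := by
  induction n using Nat.strong_induction_on with
  | _ n ih =>
    rw [expansionCoeff_apply, h0 n le_rfl, Finset.sum_eq_zero, sub_zero]
    intro i hi
    have hi := Finset.mem_range.1 hi
    rw [ih i hi fun m hm => h0 m (by omega), zero_mul]

theorem expansionCoeff_of_forall_lt {G : ℕ → A⟦X⟧} {h : A⟦X⟧} {n : ℕ}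
    (h0 : ∀ m < n, coeff m h = 0) : expansionCoeff G n h = coeff n h := by
  rw [expansionCoeff_apply, Finset.sum_eq_zero, sub_zero]
  intro i hi
  have hi := Finset.mem_range.1 hi
  rw [expansionCoeff_eq_zero_of_coeff fun m hm => h0 m (by omega), zero_mul]

theorem expansionCoeff_self {G : ℕ → A⟦X⟧} (hG : IsUnitriangular G) (d n : ℕ) :
    expansionCoeff G n (G d) = if n = d then 1 else 0 := by
  refine expansionCoeff_eq hG (c := fun n => if n = d then 1 else 0) (fun m => ?_) n
  by_cases hm : d < m + 1
  · simp [hm]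
  · simp [hm, hG.coeff_of_lt d m (by omega)]

theorem expansionCoeff_map {B : Type u} [CommRing B] (φ : A →+* B) (G : ℕ → A⟦X⟧) (h : A⟦X⟧)
    (n : ℕ) :
    expansionCoeff (fun d => PowerSeries.map φ (G d)) n (PowerSeries.map φ h) =
      φ (expansionCoeff G n h) := by
  induction n using Nat.strong_induction_on with
  | _ n ih =>
    rw [expansionCoeff_apply, expansionCoeff_apply, map_sub, map_sum, coeff_map]
    congr 1
    refine Finset.sum_congr rfl fun i hi => ?_
    rw [ih i (Finset.mem_range.1 hi), map_mul, coeff_map]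

theorem coeff_mul_eq_zero_of_forall_le {f g : A⟦X⟧} {n : ℕ} (h : ∀ m ≤ n, coeff m g = 0) :
    coeff n (f * g) = 0 := by
  rw [coeff_mul]
  refine Finset.sum_eq_zero fun x hx => ?_
  have := Finset.HasAntidiagonal.mem_antidiagonal.1 hx
  rw [h x.2 (by omega), mul_zero]

/-- The series in whose expansion along `G` only the indices in `Δ` occur. -/
noncomputable def expansionSubmodule (G : ℕ → A⟦X⟧) (Δ : Set ℕ) : Submodule A A⟦X⟧ where
  carrier := {h | ∀ d ∉ Δ, expansionCoeff G d h = 0}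
  add_mem' := fun hf hg d hd => by rw [map_add, hf d hd, hg d hd, add_zero]
  zero_mem' := fun d _ => map_zero _
  smul_mem' := fun a f hf d hd => by rw [map_smul, hf d hd, smul_zero]

/-- The submodule is closed in the `X`-adic topology, because the `d`-th expansion coefficient
depends only on the coefficients up to `d`. This lets infinite sums be treated through their partial
sums. -/
theorem mem_expansionSubmodule_of_approx {G : ℕ → A⟦X⟧} {Δ : Set ℕ} {h : A⟦X⟧}
    (H : ∀ n, ∃ f ∈ expansionSubmodule G Δ, ∀ m ≤ n, coeff m (h - f) = 0) :
    h ∈ expansionSubmodule G Δ := by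
  intro d hd
  obtain ⟨f, hf, hfd⟩ := H d
  rw [← sub_add_cancel h f, map_add, hf d hd, expansionCoeff_eq_zero_of_coeff hfd, add_zero]

theorem self_mem_expansionSubmodule {G : ℕ → A⟦X⟧} (hG : IsUnitriangular G) {Δ : Set ℕ} {d : ℕ}
    (hd : d ∈ Δ) : G d ∈ expansionSubmodule G Δ := by
  intro n hn
  rw [expansionCoeff_self hG, if_neg]
  rintro rfl
  exact hn hd

/-- Series agree up to order `n` with the partial sums of their expansions. -/
theorem coeff_sub_partialSum {G : ℕ → A⟦X⟧} (hG : IsUnitriangular G) (h : A⟦X⟧) {m n : ℕ}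
    (hmn : m ≤ n) :
    coeff m (h - ∑ i ∈ Finset.range (n + 1), expansionCoeff G i h • G i) = 0 := by
  rw [map_sub, map_sum, sub_eq_zero, coeff_eq_sum_expansionCoeff hG m h]
  simp only [map_smul, smul_eq_mul]
  refine Finset.sum_subset (by simpa using hmn) fun i _ hi => ?_
  rw [hG.coeff_of_lt i m (by simpa using hi), mul_zero]

/-- Multiplication by `r` is `X`-adically continuous, so stability need only be tested on the
members `G d` with `d ∈ Δ`. -/
theorem mul_mem_expansionSubmodule {G : ℕ → A⟦X⟧} (hG : IsUnitriangular G) {Δ : Set ℕ}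
    {r : A⟦X⟧} (hr : ∀ d ∈ Δ, r * G d ∈ expansionSubmodule G Δ) {h : A⟦X⟧}
    (hh : h ∈ expansionSubmodule G Δ) : r * h ∈ expansionSubmodule G Δ := by
  refine mem_expansionSubmodule_of_approx fun n =>
    ⟨r * ∑ i ∈ Finset.range (n + 1), expansionCoeff G i h • G i, ?_, fun m hm => ?_⟩
  · rw [Finset.mul_sum]
    refine Submodule.sum_mem _ fun i _ => ?_
    rw [mul_smul_comm]
    by_cases hi : i ∈ Δ
    · exact Submodule.smul_mem _ _ (hr i hi)
    · rw [hh i hi, zero_smul]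
      exact Submodule.zero_mem _
  · rw [← mul_sub]
    exact coeff_mul_eq_zero_of_forall_le fun l hl => coeff_sub_partialSum hG h (hl.trans hm)

theorem seriesRing_mul_mem_expansionSubmodule {G : ℕ → A⟦X⟧} {Δ : Set ℕ} {S : AddSubmonoid ℕ}
    (hS : ∀ s ∈ S, ∀ h ∈ expansionSubmodule G Δ, X ^ s * h ∈ expansionSubmodule G Δ)
    {r h : A⟦X⟧} (hr : r ∈ seriesRing A S) (hh : h ∈ expansionSubmodule G Δ) :
    r * h ∈ expansionSubmodule G Δ := by
  refine mem_expansionSubmodule_of_approx fun n =>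
    ⟨(∑ i ∈ Finset.range (n + 1), coeff i r • X ^ i) * h, ?_, fun m hm => ?_⟩
  · rw [Finset.sum_mul]
    refine Submodule.sum_mem _ fun i _ => ?_
    rw [smul_mul_assoc]
    by_cases hi : coeff i r = 0
    · rw [hi, zero_smul]
      exact Submodule.zero_mem _
    · exact Submodule.smul_mem _ _ (hS i (hr i hi) h hh)
  · rw [← sub_mul, mul_comm]
    refine coeff_mul_eq_zero_of_forall_le fun l hl => ?_
    have hl : l < n + 1 := by omega
    simp [coeff_X_pow, hl]

/-- A series whose leading coefficient sits at an index in `Δ`, if there is one, and whose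
coefficients at all indices in `Δ` vanish, is zero. -/
theorem eq_zero_of_forall_coeff {Δ : Set ℕ} {f : A⟦X⟧}
    (hf : ∀ d ∉ Δ, (∀ n < d, coeff n f = 0) → coeff d f = 0) {N : ℕ}
    (h : ∀ n ∈ Δ, n < N → coeff n f = 0) (n : ℕ) (hn : n < N) : coeff n f = 0 := by
  induction n using Nat.strong_induction_on with
  | _ n ih =>
    by_cases hd : n ∈ Δ
    · exact h n hd hn
    · exact hf n hd fun m hm => ih m hm (hm.trans hn)

end Expansion

/-! ### Standardness follows from the jumps below `rk` -/

section Standard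

variable {A : Type u} [CommRing A] {rk p q : ℕ}

/-- The translates `z^m * f i` form a unitriangular family; sorting an expansion along it by
residues mod `rk` gives coefficients of the `f i` in `A[[z]]`. -/
theorem isStandard_of_jumps (hrk : 0 < rk) {M : Submodule (torusRing A rk p q) A⟦X⟧}
    (hM : ∀ i < rk, ∃ f ∈ M, (∀ n < i, coeff n f = 0) ∧ coeff i f = 1) : IsStandard M := by
  choose! f hfM hf0 hf1 using hM
  let G : ℕ → A⟦X⟧ := fun n => X ^ (rk * (n / rk)) * f (n % rk)
  have hG : IsUnitriangular G := by
    constructor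
    · intro d n hn
      rw [coeff_X_pow_mul']
      split_ifs with h
      · apply hf0 _ (Nat.mod_lt _ hrk)
        have := Nat.div_add_mod d rk
        omega
      · rfl
    · intro d
      have := Nat.div_add_mod d rk
      rw [coeff_X_pow_mul', if_pos (by omega), show d - rk * (d / rk) = d % rk by omega]
      exact hf1 _ (Nat.mod_lt _ hrk)
  refine Submodule.eq_top_iff'.2 fun h => ?_
  -- The expansion coefficient at index `i + rk * m` becomes the coefficient of `z^m` in the
  -- multiplier of `f i`.
  let g : ℕ → A⟦X⟧ := fun i => PowerSeries.mk fun n =>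
    if rk ∣ n then expansionCoeff G (i + n) h else 0
  have hg : ∀ i, g i ∈ baseRing A rk := by
    intro i n hn
    by_cases hd : rk ∣ n
    · obtain ⟨m, rfl⟩ := hd
      exact ⟨m, by simp [mul_comm]⟩
    · simp [g, hd] at hn
  have hsum : h = ∑ i ∈ Finset.range rk, g i * f i := by
    ext n
    have hgn : ∀ i, coeff n (g i * f i) = ∑ m ∈ Finset.range (n + 1),
        expansionCoeff G (i + rk * m) h * coeff n (X ^ (rk * m) * f i) := by
      intro i
      rw [coeff_mul, Finset.Nat.sum_antidiagonal_eq_sum_range_succ_mk]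
      have h1 : ∀ j ∈ Finset.range (n + 1), coeff j (g i) * coeff (n - j) (f i) =
          ∑ m ∈ Finset.range (n + 1), if j = rk * m then
            expansionCoeff G (i + rk * m) h * coeff n (X ^ (rk * m) * f i) else 0 := by
        intro j hj
        have hj := Finset.mem_range.1 hj
        by_cases hd : rk ∣ j
        · obtain ⟨m, rfl⟩ := hd
          have hm : m < n + 1 := lt_of_le_of_lt (Nat.le_mul_of_pos_left m hrk) hj
          rw [Finset.sum_eq_single m]
          · simp [g, coeff_X_pow_mul', Nat.lt_succ_iff.1 hj]
          · intro l _ hl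
            rw [if_neg]
            intro h
            exact hl (Nat.eq_of_mul_eq_mul_left hrk h).symm
          · intro h
            exact absurd (Finset.mem_range.2 hm) h
        · rw [Finset.sum_eq_zero]
          · simp [g, hd]
          · intro m _
            rw [if_neg]
            rintro rfl
            exact hd ⟨m, rfl⟩
      rw [Finset.sum_congr rfl h1, Finset.sum_comm]
      refine Finset.sum_congr rfl fun m _ => ?_
      rw [Finset.sum_ite_eq']
      split_ifs with hm
      · rfl
      · rw [coeff_X_pow_mul', if_neg (by simpa using hm), mul_zero]
    rw [map_sum, Finset.sum_congr rfl fun i _ => hgn i]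
    -- The range is enlarged by vanishing terms so that quotient and remainder by `rk` identify it
    -- with a product of two ranges.
    have h2 : coeff n h = ∑ l ∈ Finset.range (rk * (n + 1)),
        expansionCoeff G l h * coeff n (G l) := by
      rw [coeff_eq_sum_expansionCoeff hG n h]
      refine Finset.sum_subset (Finset.range_subset_range.2 (Nat.le_mul_of_pos_left _ hrk)) fun i _ hi => ?_
      rw [hG.coeff_of_lt i n (by simpa using hi), mul_zero]
    rw [h2, ← Finset.sum_product']
    refine Finset.sum_bij' (fun l _ => (l % rk, l / rk)) (fun x _ => x.1 + rk * x.2) ?_ ?_ ?_ ?_ ?_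
    · intro l hl
      simp only [Finset.mem_product, Finset.mem_range] at hl ⊢
      exact ⟨Nat.mod_lt _ hrk, Nat.div_lt_of_lt_mul hl⟩
    · rintro ⟨i, m⟩ hx
      simp only [Finset.mem_product, Finset.mem_range] at hx ⊢
      have : rk * m + rk ≤ rk * (n + 1) := by
        rw [← Nat.mul_succ]
        exact Nat.mul_le_mul_left _ hx.2
      omega
    · intro l _
      exact Nat.mod_add_div l rk
    · rintro ⟨i, m⟩ hx
      simp only [Finset.mem_product, Finset.mem_range] at hx
      simp [Nat.mod_eq_of_lt hx.1, Nat.add_mul_div_left _ _ hrk, Nat.div_eq_of_lt hx.1]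
    · intro l _
      simp only [Nat.mod_add_div, G]
  rw [hsum]
  refine Submodule.sum_mem _ fun i hi => ?_
  exact Submodule.smul_mem _ (⟨g i, hg i⟩ : baseRing A rk)
    (Submodule.subset_span (hfM i (Finset.mem_range.1 hi)))

end Standard

end TorusCell

namespace TorusCell

/-! ### Least elements of `Δ` in the residue classes modulo `rk * p` -/

/-- The least element of `Δ` in the residue class `s` modulo `rk * p`. -/
noncomputable def classMin (rk p : ℕ) (Δ : Set ℕ) (s : ZMod (rk * p)) : ℕ :=
  sInf {x | x ∈ Δ ∧ (x : ZMod (rk * p)) = s}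

section ClassMin

variable {rk p q : ℕ} {Δ : Set ℕ}

theorem IsStandardSet.add_mul_mem (hΔ : IsStandardSet rk p q Δ) {d : ℕ} (hd : d ∈ Δ) (a b : ℕ) :
    d + rk * p * a + rk * q * b ∈ Δ := by
  have h := hΔ.add_mem _ ((mem_semigroup_iff rk p q _).2 ⟨a, b, rfl⟩) d hd
  convert h using 1
  ring

theorem IsStandardSet.add_left_mem (hΔ : IsStandardSet rk p q Δ) {d : ℕ} (hd : d ∈ Δ) (a : ℕ) :
    d + rk * p * a ∈ Δ := by
  simpa using hΔ.add_mul_mem hd a 0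

theorem IsStandardSet.add_right_mem (hΔ : IsStandardSet rk p q Δ) {d : ℕ} (hd : d ∈ Δ) :
    d + rk * q ∈ Δ := by
  simpa using hΔ.add_mul_mem hd 0 1

/-- Multiples of `z` beyond `z ^ (p * q)` have exponents in the semigroup. -/
theorem mul_mem_semigroup (hp : 0 < p) (hpq : p.Coprime q) {n : ℕ} (hn : p * q ≤ n) :
    rk * n ∈ semigroup rk p q := by
  obtain ⟨y, hy, hyn⟩ := Nat.exists_mul_mod_eq_of_coprime n hpq.symm hp.ne'
  have hle : q * y ≤ n := (Nat.mul_le_mul_left q hy.le).trans (by rwa [mul_comm])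
  obtain ⟨m, hm⟩ := (Nat.modEq_iff_dvd' hle).1 hyn
  refine (mem_semigroup_iff _ _ _ _).2 ⟨m, y, ?_⟩
  rw [show n = p * m + q * y by omega]
  ring

theorem IsStandardSet.mem_of_le (hrk : 0 < rk) (hp : 0 < p) (hpq : p.Coprime q)
    (hΔ : IsStandardSet rk p q Δ) {n : ℕ} (hn : rk * (p * q) ≤ n) : n ∈ Δ := by
  have h := hΔ.add_mem _ (mul_mem_semigroup (rk := rk) (n := n / rk) hp hpq
    ((Nat.le_div_iff_mul_le hrk).2 (by rwa [mul_comm]))) _ (hΔ.lt_mem _ (Nat.mod_lt n hrk))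
  rwa [Nat.div_add_mod] at h

theorem classMin_spec (hrk : 0 < rk) (hp : 0 < p) (hpq : p.Coprime q)
    (hΔ : IsStandardSet rk p q Δ) (s : ZMod (rk * p)) :
    classMin rk p Δ s ∈ Δ ∧ (classMin rk p Δ s : ZMod (rk * p)) = s := by
  have : NeZero (rk * p) := ⟨(Nat.mul_pos hrk hp).ne'⟩
  refine Nat.sInf_mem (s := {x | x ∈ Δ ∧ (x : ZMod (rk * p)) = s})
    ⟨s.val + rk * p * (rk * (p * q)), hΔ.mem_of_le hrk hp hpq ?_, by simp⟩
  exact (Nat.le_mul_of_pos_left _ (Nat.mul_pos hrk hp)).trans (Nat.le_add_left _ _)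

theorem classMin_le {d : ℕ} (hd : d ∈ Δ) : classMin rk p Δ d ≤ d :=
  Nat.sInf_le ⟨hd, rfl⟩

theorem exists_eq_classMin_add {d : ℕ} (hrk : 0 < rk) (hp : 0 < p) (hpq : p.Coprime q)
    (hΔ : IsStandardSet rk p q Δ) (hd : d ∈ Δ) :
    ∃ m, d = classMin rk p Δ d + rk * p * m := by
  have h := (ZMod.natCast_eq_natCast_iff _ _ _).1 (classMin_spec hrk hp hpq hΔ d).2
  obtain ⟨m, hm⟩ := (Nat.modEq_iff_dvd' (classMin_le hd)).1 h
  have := classMin_le (rk := rk) (p := p) hd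
  exact ⟨m, by omega⟩

/-- Every orbit of `s ↦ s + rk * q` contains a class `s` for which `b_s + g + rk * q ∈ Δ`. -/
theorem exists_classMin_add_mem (hrk : 0 < rk) (hp : 0 < p) (hpq : p.Coprime q)
    (hΔ : IsStandardSet rk p q Δ) (g : ℕ) (s : ZMod (rk * p)) :
    ∃ t : ℕ, classMin rk p Δ (s + t * (rk * q : ℕ)) + rk * q + g ∈ Δ := by
  set x := classMin rk p Δ s + rk * q + g with hx
  -- The factor `p - 1` plays the role of `-1` mod `p`: moving `y` steps along the orbit cancels the
  -- quotient `x / rk`, leaving the residue `x % rk`.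
  obtain ⟨y, -, hy⟩ := Nat.exists_mul_mod_eq_of_coprime ((p - 1) * (x / rk)) hpq.symm hp.ne'
  refine ⟨y, ?_⟩
  set n := classMin rk p Δ (s + y * (rk * q : ℕ)) + rk * q + g with hn
  have hi : x % rk < rk := Nat.mod_lt _ hrk
  have h1 : (n : ZMod (rk * p)) = (x % rk : ℕ) := by
    have h2 : (n : ZMod (rk * p)) = (x + rk * (q * y) : ℕ) := by
      rw [hn, hx]
      push_cast
      rw [(classMin_spec hrk hp hpq hΔ _).2, (classMin_spec hrk hp hpq hΔ _).2]
      ring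
    rw [h2, ZMod.natCast_eq_natCast_iff]
    have h3 : rk * (q * y) ≡ rk * ((p - 1) * (x / rk)) [MOD rk * p] := Nat.ModEq.mul_left' rk hy
    refine (h3.add_left x).trans ?_
    have h4 : x + rk * ((p - 1) * (x / rk)) = x % rk + rk * p * (x / rk) := by
      obtain ⟨r, rfl⟩ : ∃ r, p = r + 1 := ⟨p - 1, by omega⟩
      nth_rewrite 1 [← Nat.mod_add_div x rk]
      simp only [Nat.add_sub_cancel]
      ring
    rw [h4]
    simp [Nat.ModEq]
  have h5 := (ZMod.natCast_eq_natCast_iff _ _ _).1 h1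
  -- Since `x % rk` is already reduced mod `rk * p`, the number `n` is `x % rk` plus a multiple of
  -- `rk * p`, and `x % rk ∈ Δ` by standardness.
  have h6 : x % rk < rk * p := hi.trans_le (Nat.le_mul_of_pos_right _ hp)
  rw [Nat.ModEq, Nat.mod_eq_of_lt h6] at h5
  have h7 := hΔ.add_left_mem (hΔ.lt_mem _ hi) (n / (rk * p))
  rwa [← h5, Nat.mod_add_div] at h7

end ClassMin

/-! ### Recursions along the orbits of a translation -/

section CyclicRecursion

variable {Z A : Type*} [AddCommGroup Z] [AddCommGroup A]

/-- Walk from `s` in steps of `a` until the first exit from `E`; take the value `v` there and add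
the `c` collected on the way. -/
theorem exists_cyclic_recursion (a : Z) (E : Set Z) (hE : ∀ s, ∃ t : ℕ, s + t • a ∉ E)
    (v c : Z → A) : ∃ x : Z → A, (∀ s ∉ E, x s = v s) ∧ ∀ s ∈ E, x s = x (s + a) + c s := by
  classical
  let T : Z → ℕ := fun s => Nat.find (hE s)
  refine ⟨fun s => v (s + T s • a) + ∑ i ∈ Finset.range (T s), c (s + i • a), ?_, ?_⟩
  · intro s hs
    have h : T s = 0 := (Nat.find_eq_zero (hE s)).2 (by simpa using hs)
    simp [h]
  · intro s hs
    have h : T s = T (s + a) + 1 := by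
      refine (Nat.find_eq_iff (hE s)).2 ⟨?_, fun n hn => ?_⟩
      · have := Nat.find_spec (hE (s + a))
        rwa [add_assoc, ← succ_nsmul'] at this
      · cases n with
        | zero => simpa using hs
        | succ n =>
          have := Nat.find_min (hE (s + a)) (show n < T (s + a) by omega)
          rwa [add_assoc, ← succ_nsmul'] at this
    simp only [h]
    rw [Finset.sum_range_succ', succ_nsmul', ← add_assoc]
    simp only [zero_nsmul, add_zero, succ_nsmul', ← add_assoc]

theorem cyclic_recursion_unique (a : Z) (E : Set Z) (hE : ∀ s, ∃ t : ℕ, s + t • a ∉ E)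
    {x : Z → A} (h0 : ∀ s ∉ E, x s = 0) (h1 : ∀ s ∈ E, x s = x (s + a)) (s : Z) : x s = 0 := by
  obtain ⟨t, ht⟩ := hE s
  induction t generalizing s with
  | zero => exact h0 s (by simpa using ht)
  | succ t ih =>
    by_cases hs : s ∈ E
    · rw [h1 s hs]
      apply ih
      rwa [add_assoc, ← succ_nsmul']
    · exact h0 s hs

end CyclicRecursion

/-! ### Solving the syzygy equations degree by degree -/

section Syzygy

variable {A : Type u} [CommRing A] {rk p q : ℕ} {Δ : Set ℕ}

/-- `l s g` are the coefficients of the reduced generators `X ^ b_s * ∑ l s g * X ^ g` of a point of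
the cell, and `m s g` those of the expansions of their multiples by `z ^ q` along the generators. -/
structure IsSyzygy (rk p q : ℕ) (Δ : Set ℕ) (l m : ZMod (rk * p) → ℕ → A) : Prop where
  left_zero : ∀ s, l s 0 = 1
  left_mem : ∀ s g, 0 < g → classMin rk p Δ s + g ∈ Δ → l s g = 0
  right_notMem : ∀ s g, classMin rk p Δ s + rk * q + g ∉ Δ → m s g = 0
  eq : ∀ s g, l s g = ∑ i ∈ Finset.range (g + 1), m s i * l (s + (rk * q : ℕ) + i) (g - i)

/-- The positions of the free coefficients of the reduced generators. -/
def freeSet (rk p q : ℕ) (Δ : Set ℕ) : Set (ZMod (rk * p) × ℕ) :=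
  {x | classMin rk p Δ x.1 + x.2 ∉ Δ ∧ classMin rk p Δ x.1 + rk * q + x.2 ∈ Δ}

theorem IsSyzygy.right_zero {l m : ZMod (rk * p) → ℕ → A} (h : IsSyzygy rk p q Δ l m)
    (s : ZMod (rk * p)) : m s 0 = 1 := by
  have := h.eq s 0
  simpa [h.left_zero] using this.symm

/-- The extreme terms of the convolution are split off, so that everything in the middle sum has
degree at most `g` and is known by induction. -/
theorem IsSyzygy.eq_succ {l m : ZMod (rk * p) → ℕ → A} (h : IsSyzygy rk p q Δ l m)
    (s : ZMod (rk * p)) (g : ℕ) :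
    l s (g + 1) = l (s + (rk * q : ℕ)) (g + 1) +
      (∑ i ∈ Finset.range g, m s (i + 1) * l (s + (rk * q : ℕ) + (i + 1 : ℕ)) (g - i)) +
      m s (g + 1) := by
  rw [h.eq, Finset.sum_range_succ, Finset.sum_range_succ', h.right_zero, Nat.sub_self,
    h.left_zero]
  simp only [Nat.add_sub_add_right, Nat.cast_zero, add_zero, Nat.sub_zero, one_mul, mul_one]
  ring

theorem IsSyzygy.map {B : Type u} [CommRing B] (φ : A →+* B) {l m : ZMod (rk * p) → ℕ → A}
    (h : IsSyzygy rk p q Δ l m) :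
    IsSyzygy rk p q Δ (fun s g => φ (l s g)) (fun s g => φ (m s g)) where
  left_zero s := by rw [h.left_zero, map_one]
  left_mem s g hg hd := by rw [h.left_mem s g hg hd, map_zero]
  right_notMem s g hd := by rw [h.right_notMem s g hd, map_zero]
  eq s g := by rw [h.eq, map_sum]; simp

theorem exists_add_nsmul_notMem (hrk : 0 < rk) (hp : 0 < p) (hpq : p.Coprime q)
    (hΔ : IsStandardSet rk p q Δ) (g : ℕ) (s : ZMod (rk * p)) :
    ∃ t : ℕ, s + t • ((rk * q : ℕ) : ZMod (rk * p)) ∉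
      {s | classMin rk p Δ s + rk * q + g ∉ Δ} := by
  obtain ⟨t, ht⟩ := exists_classMin_add_mem hrk hp hpq hΔ g s
  exact ⟨t, by simpa [nsmul_eq_mul] using ht⟩

/-- A syzygy is determined by its free coefficients. -/
theorem IsSyzygy.ext (hrk : 0 < rk) (hp : 0 < p) (hpq : p.Coprime q)
    (hΔ : IsStandardSet rk p q Δ) {l m l' m' : ZMod (rk * p) → ℕ → A}
    (h : IsSyzygy rk p q Δ l m) (h' : IsSyzygy rk p q Δ l' m')
    (hfree : ∀ x ∈ freeSet rk p q Δ, l x.1 x.2 = l' x.1 x.2) : l = l' := by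
  suffices H : ∀ g, (∀ s, l s g = l' s g) ∧ ∀ s, m s g = m' s g from
    funext₂ fun s g => (H g).1 s
  intro g
  induction g using Nat.strong_induction_on with
  | _ g ih =>
    cases g with
    | zero =>
      exact ⟨fun s => by rw [h.left_zero, h'.left_zero],
        fun s => by rw [h.right_zero, h'.right_zero]⟩
    | succ g =>
      have hmid : ∀ s : ZMod (rk * p),
          ∑ i ∈ Finset.range g, m s (i + 1) * l (s + (rk * q : ℕ) + (i + 1 : ℕ)) (g - i) =
          ∑ i ∈ Finset.range g, m' s (i + 1) * l' (s + (rk * q : ℕ) + (i + 1 : ℕ)) (g - i) := by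
        intro s
        refine Finset.sum_congr rfl fun i hi => ?_
        have hi := Finset.mem_range.1 hi
        rw [(ih (i + 1) (by omega)).2, (ih (g - i) (by omega)).1]
      have hl : ∀ s, l s (g + 1) = l' s (g + 1) := by
        intro s
        -- The difference of the two solutions satisfies the homogeneous recursion: both `m`-terms
        -- vanish on the exceptional set, and off it the difference is zero.
        refine sub_eq_zero.1 (cyclic_recursion_unique ((rk * q : ℕ) : ZMod (rk * p)) _
          (exists_add_nsmul_notMem hrk hp hpq hΔ (g + 1))
          (x := fun s => l s (g + 1) - l' s (g + 1)) ?_ ?_ s)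
        · intro s hs
          have hs : classMin rk p Δ s + rk * q + (g + 1) ∈ Δ := by simpa using hs
          by_cases hd : classMin rk p Δ s + (g + 1) ∈ Δ
          · simp only [h.left_mem s _ g.succ_pos hd, h'.left_mem s _ g.succ_pos hd, sub_zero]
          · exact sub_eq_zero.2 (hfree (s, g + 1) ⟨hd, hs⟩)
        · intro s hs
          have hs : classMin rk p Δ s + rk * q + (g + 1) ∉ Δ := hs
          simp only [h.eq_succ s g, h'.eq_succ s g, hmid, h.right_notMem s _ hs,
            h'.right_notMem s _ hs]
          ring
      refine ⟨hl, fun s => ?_⟩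
      have h1 := h.eq_succ s g
      rw [hl, hl, hmid, h'.eq_succ s g] at h1
      exact (add_left_cancel h1).symm

open Classical in
/-- The syzygy with given free coefficients `v`, by recursion on the degree. -/
noncomputable def syzygy (rk p q : ℕ) (Δ : Set ℕ) (v : ZMod (rk * p) → ℕ → A) :
    ℕ → (ZMod (rk * p) → A) × (ZMod (rk * p) → A)
  | 0 => (1, 1)
  | g + 1 =>
    let mid : ZMod (rk * p) → A := fun s => ∑ i : Fin g,
      (syzygy rk p q Δ v (i + 1)).2 s *
        (syzygy rk p q Δ v (g - i)).1 (s + (rk * q : ℕ) + (i + 1 : ℕ))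
    let E : Set (ZMod (rk * p)) := {s | classMin rk p Δ s + rk * q + (g + 1) ∉ Δ}
    -- On `E` no `m`-term is allowed, so the equation constrains `l`; off `E` the value is
    -- prescribed and `m` takes up the defect. `exists_cyclic_recursion` shows that such a function
    -- exists.
    let l : ZMod (rk * p) → A := Classical.epsilon fun x =>
      (∀ s ∉ E, x s = v s (g + 1)) ∧ ∀ s ∈ E, x s = x (s + (rk * q : ℕ)) + mid s
    (l, fun s => if s ∈ E then 0 else l s - l (s + (rk * q : ℕ)) - mid s)

/-- Free coefficients can be prescribed. -/
theorem exists_isSyzygy (hrk : 0 < rk) (hp : 0 < p) (hpq : p.Coprime q)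
    (hΔ : IsStandardSet rk p q Δ) (v : ZMod (rk * p) → ℕ → A)
    (hv : ∀ s g, (s, g) ∉ freeSet rk p q Δ → v s g = 0) :
    ∃ l m : ZMod (rk * p) → ℕ → A, IsSyzygy rk p q Δ l m ∧
      ∀ x ∈ freeSet rk p q Δ, l x.1 x.2 = v x.1 x.2 := by
  classical
  let l : ZMod (rk * p) → ℕ → A := fun s g => (syzygy rk p q Δ v g).1 s
  let m : ZMod (rk * p) → ℕ → A := fun s g => (syzygy rk p q Δ v g).2 s
  let mid : ℕ → ZMod (rk * p) → A := fun g s =>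
    ∑ i ∈ Finset.range g, m s (i + 1) * l (s + (rk * q : ℕ) + (i + 1 : ℕ)) (g - i)
  have hmid : ∀ g s, (∑ i : Fin g, (syzygy rk p q Δ v (i + 1)).2 s *
        (syzygy rk p q Δ v (g - i)).1 (s + (rk * q : ℕ) + (i + 1 : ℕ))) = mid g s :=
    fun g s => Fin.sum_univ_eq_sum_range
      (fun i => m s (i + 1) * l (s + (rk * q : ℕ) + (i + 1 : ℕ)) (g - i)) g
  have hl : ∀ g, (∀ s, classMin rk p Δ s + rk * q + (g + 1) ∈ Δ → l s (g + 1) = v s (g + 1)) ∧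
      ∀ s, classMin rk p Δ s + rk * q + (g + 1) ∉ Δ →
        l s (g + 1) = l (s + (rk * q : ℕ)) (g + 1) + mid g s := by
    intro g
    have h := Classical.epsilon_spec (exists_cyclic_recursion ((rk * q : ℕ) : ZMod (rk * p)) _
      (exists_add_nsmul_notMem hrk hp hpq hΔ (g + 1)) (fun s => v s (g + 1)) (mid g))
    simp only [Set.mem_ofPred_eq, not_not] at h
    simp only [l]
    rw [syzygy]
    simp only [hmid, Set.mem_ofPred_eq, not_not]
    exact h
  have hm : ∀ g s, m s (g + 1) = if classMin rk p Δ s + rk * q + (g + 1) ∉ Δ then 0 else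
      l s (g + 1) - l (s + (rk * q : ℕ)) (g + 1) - mid g s := by
    intro g s
    simp only [l, m]
    rw [syzygy]
    simp only [hmid, Set.mem_ofPred_eq]
  have hl0 : ∀ s, l s 0 = 1 := fun s => by simp only [l]; rw [syzygy]; rfl
  have hm0 : ∀ s, m s 0 = 1 := fun s => by simp only [m]; rw [syzygy]; rfl
  refine ⟨l, m, ⟨hl0, ?_, ?_, ?_⟩, ?_⟩
  · intro s g hg hd
    obtain ⟨g, rfl⟩ : ∃ r, g = r + 1 := ⟨g - 1, by omega⟩
    have hd' := hΔ.add_right_mem hd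
    -- Here `v` must vanish off the free set: an index in `Δ` stays in `Δ` after adding `rk * q`, so
    -- `l` takes the value of `v` there, which has to be zero.
    rw [(hl g).1 s (by convert hd' using 1; ring), hv]
    exact fun h => h.1 hd
  · intro s g hd
    cases g with
    | zero => exact absurd (hΔ.add_right_mem (classMin_spec hrk hp hpq hΔ s).1) hd
    | succ g => rw [hm, if_pos hd]
  · intro s g
    cases g with
    | zero => simp [hl0, hm0]
    | succ g =>
      have h1 : l s (g + 1) = l (s + (rk * q : ℕ)) (g + 1) + mid g s + m s (g + 1) := by
        by_cases hd : classMin rk p Δ s + rk * q + (g + 1) ∈ Δ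
        · rw [hm, if_neg (not_not.2 hd)]
          ring
        · rw [hm, if_pos hd, add_zero]
          exact (hl g).2 s hd
      rw [h1, Finset.sum_range_succ, Finset.sum_range_succ', hm0, Nat.sub_self, hl0]
      simp only [Nat.add_sub_add_right, Nat.cast_zero, add_zero, Nat.sub_zero, one_mul, mul_one,
        mid]
      ring
  · rintro ⟨s, g⟩ hx
    cases g with
    | zero => exact absurd (classMin_spec hrk hp hpq hΔ s).1 hx.1
    | succ g => exact (hl g).1 s hx.2

end Syzygy

end TorusCell

namespace TorusCell

/-! ### From a syzygy to a point of the cell -/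

section BasisSeries

variable {A : Type u} [CommRing A] {rk p q : ℕ} {Δ : Set ℕ}

/-- The series `X ^ d * ∑ l d g * X ^ g`. -/
noncomputable def basisSeries (l : ZMod (rk * p) → ℕ → A) (d : ℕ) : A⟦X⟧ :=
  X ^ d * PowerSeries.mk (l d)

theorem coeff_basisSeries (l : ZMod (rk * p) → ℕ → A) (d n : ℕ) :
    coeff n (basisSeries l d) = if d ≤ n then l d (n - d) else 0 := by
  rw [basisSeries, coeff_X_pow_mul']
  simp

theorem isUnitriangular_basisSeries {l : ZMod (rk * p) → ℕ → A} (hl : ∀ s, l s 0 = 1) :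
    IsUnitriangular (basisSeries l) where
  coeff_of_lt d n h := by rw [coeff_basisSeries, if_neg (by omega)]
  coeff_self d := by rw [coeff_basisSeries, if_pos le_rfl, Nat.sub_self, hl]

theorem basisSeries_add_left (l : ZMod (rk * p) → ℕ → A) (d m : ℕ) :
    basisSeries l (d + rk * p * m) = X ^ (rk * p * m) * basisSeries l d := by
  have h : ((d + rk * p * m : ℕ) : ZMod (rk * p)) = d := by
    rw [ZMod.natCast_eq_natCast_iff]
    simp [Nat.ModEq]
  rw [basisSeries, basisSeries, h, pow_add]
  ring

theorem map_basisSeries {B : Type u} [CommRing B] (φ : A →+* B) (l : ZMod (rk * p) → ℕ → A)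
    (d : ℕ) :
    PowerSeries.map φ (basisSeries l d) = basisSeries (fun s g => φ (l s g)) d := by
  ext n
  rw [coeff_map, coeff_basisSeries, coeff_basisSeries]
  split_ifs <;> simp

theorem X_pow_left_mul_mem {l : ZMod (rk * p) → ℕ → A} (hl : ∀ s, l s 0 = 1)
    (hΔ : IsStandardSet rk p q Δ) (m : ℕ) {h : A⟦X⟧}
    (hh : h ∈ expansionSubmodule (basisSeries l) Δ) :
    X ^ (rk * p * m) * h ∈ expansionSubmodule (basisSeries l) Δ := by
  refine mul_mem_expansionSubmodule (isUnitriangular_basisSeries hl) (fun d hd => ?_) hh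
  rw [← basisSeries_add_left]
  exact self_mem_expansionSubmodule (isUnitriangular_basisSeries hl) (hΔ.add_left_mem hd m)

/-- The syzygy equation is the coefficientwise form of `z^q * G b = ∑ m s i • G (b + rk*q + i)` with
`b = b_s`, and `m` vanishes at the indices outside `Δ`. -/
theorem IsSyzygy.X_pow_right_mul_generator_mem (hrk : 0 < rk) (hp : 0 < p) (hpq : p.Coprime q)
    (hΔ : IsStandardSet rk p q Δ) {l m : ZMod (rk * p) → ℕ → A} (h : IsSyzygy rk p q Δ l m)
    (s : ZMod (rk * p)) :
    X ^ (rk * q) * basisSeries l (classMin rk p Δ s) ∈ expansionSubmodule (basisSeries l) Δ := by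
  have hG := isUnitriangular_basisSeries h.left_zero
  set b := classMin rk p Δ s with hb
  have hbs : (b : ZMod (rk * p)) = s := (classMin_spec hrk hp hpq hΔ s).2
  refine mem_expansionSubmodule_of_approx fun n =>
    ⟨∑ i ∈ Finset.range (n + 1), m s i • basisSeries l (b + rk * q + i), ?_, fun j hj => ?_⟩
  · refine Submodule.sum_mem _ fun i _ => ?_
    by_cases hi : b + rk * q + i ∈ Δ
    · exact Submodule.smul_mem _ _ (self_mem_expansionSubmodule hG hi)
    · rw [h.right_notMem s i hi, zero_smul]
      exact Submodule.zero_mem _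
  · rw [map_sub, map_sum, sub_eq_zero, coeff_X_pow_mul', coeff_basisSeries, hbs]
    simp only [map_smul, coeff_basisSeries, smul_eq_mul]
    by_cases hjb : b + rk * q ≤ j
    · obtain ⟨g, rfl⟩ := Nat.exists_eq_add_of_le hjb
      rw [if_pos (by omega), if_pos (by omega), show b + rk * q + g - rk * q - b = g by omega,
        h.eq]
      have hsub : Finset.range (g + 1) ⊆ Finset.range (n + 1) :=
        Finset.range_subset_range.2 (by omega)
      rw [← Finset.sum_subset hsub]
      · refine Finset.sum_congr rfl fun i hi => ?_
        have hi := Finset.mem_range.1 hi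
        rw [if_pos (by omega), show b + rk * q + g - (b + rk * q + i) = g - i by omega]
        push_cast
        rw [hbs]
      · intro i _ hi
        have hi := mt Finset.mem_range.2 hi
        rw [if_neg (by omega), mul_zero]
    · rw [Finset.sum_eq_zero fun i _ => by rw [if_neg (by omega), mul_zero]]
      split_ifs <;> first | rfl | omega

theorem IsSyzygy.X_pow_mul_mem (hrk : 0 < rk) (hp : 0 < p) (hpq : p.Coprime q)
    (hΔ : IsStandardSet rk p q Δ) {l m : ZMod (rk * p) → ℕ → A} (h : IsSyzygy rk p q Δ l m)
    {e : ℕ} (he : e ∈ semigroup rk p q) :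
    ∀ f ∈ expansionSubmodule (basisSeries l) Δ,
      X ^ e * f ∈ expansionSubmodule (basisSeries l) Δ := by
  induction he using AddSubmonoid.closure_induction with
  | mem e he =>
    intro f hf
    rcases he with rfl | rfl
    · simpa using X_pow_left_mul_mem h.left_zero hΔ 1 hf
    · refine mul_mem_expansionSubmodule (isUnitriangular_basisSeries h.left_zero)
        (fun d hd => ?_) hf
      obtain ⟨n, hn⟩ := exists_eq_classMin_add hrk hp hpq hΔ hd
      rw [hn, basisSeries_add_left, mul_left_comm]
      exact X_pow_left_mul_mem h.left_zero hΔ n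
        (h.X_pow_right_mul_generator_mem hrk hp hpq hΔ _)
  | zero =>
    intro f hf
    simpa using hf
  | add a b _ _ ha hb =>
    intro f hf
    rw [pow_add, mul_assoc]
    exact ha _ (hb f hf)

/-- The point of the cell with a given syzygy. -/
noncomputable def IsSyzygy.toSubmodule (hrk : 0 < rk) (hp : 0 < p) (hpq : p.Coprime q)
    (hΔ : IsStandardSet rk p q Δ) {l m : ZMod (rk * p) → ℕ → A} (h : IsSyzygy rk p q Δ l m) :
    Submodule (torusRing A rk p q) A⟦X⟧ where
  carrier := expansionSubmodule (basisSeries l) Δ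
  add_mem' := Submodule.add_mem _
  zero_mem' := Submodule.zero_mem _
  smul_mem' r _ hf := seriesRing_mul_mem_expansionSubmodule
    (fun _ hs => h.X_pow_mul_mem hrk hp hpq hΔ hs) r.2 hf

theorem IsSyzygy.toSubmodule_mem_cell (hrk : 0 < rk) (hp : 0 < p) (hpq : p.Coprime q)
    (hΔ : IsStandardSet rk p q Δ) {l m : ZMod (rk * p) → ℕ → A} (h : IsSyzygy rk p q Δ l m) :
    h.toSubmodule hrk hp hpq hΔ ∈ cell A rk p q Δ := by
  have hG := isUnitriangular_basisSeries h.left_zero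
  have hjump : ∀ d ∈ Δ, ∃ f ∈ h.toSubmodule hrk hp hpq hΔ,
      (∀ n < d, coeff n f = 0) ∧ coeff d f = 1 := fun d hd =>
    ⟨basisSeries l d, self_mem_expansionSubmodule hG hd, hG.coeff_of_lt d, hG.coeff_self d⟩
  refine ⟨isStandard_of_jumps hrk fun i hi => hjump i (hΔ.lt_mem i hi), hjump, ?_⟩
  intro d hd f hf h0
  rw [← expansionCoeff_of_forall_lt (G := basisSeries l) h0]
  exact hf d hd

end BasisSeries

/-! ### From a point of the cell to a syzygy -/

section Reduced

variable {A : Type u} [CommRing A] {rk p q : ℕ} {Δ : Set ℕ}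
  {M : Submodule (torusRing A rk p q) A⟦X⟧}

theorem smul_mem_of_mem (a : A) {f : A⟦X⟧} (hf : f ∈ M) : a • f ∈ M := by
  rw [smul_eq_C_mul]
  exact M.smul_mem ⟨C a, (torusRing A rk p q).algebraMap_mem a⟩ hf

theorem X_pow_mul_mem_of_mem {e : ℕ} (he : e ∈ semigroup rk p q) {f : A⟦X⟧} (hf : f ∈ M) :
    X ^ e * f ∈ M := by
  refine M.smul_mem (⟨X ^ e, fun n hn => ?_⟩ : torusRing A rk p q) hf
  rw [coeff_X_pow] at hn
  by_cases h : n = e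
  · rwa [h]
  · simp [h] at hn

theorem eq_zero_of_mem_cell (hM : M ∈ cell A rk p q Δ) {f : A⟦X⟧} (hf : f ∈ M)
    (h : ∀ n ∈ Δ, coeff n f = 0) : f = 0 := by
  ext n
  exact eq_zero_of_forall_coeff (fun d hd h0 => hM.2.2 d hd f hf h0)
    (N := n + 1) (fun m hm _ => h m hm) n n.lt_succ_self

/-- Every series is congruent modulo `M` to one without exponents in `Δ`. -/
theorem exists_sub_forall_coeff (hp : 0 < p) (hpq : p.Coprime q)
    (hM : M ∈ cell A rk p q Δ) (h : A⟦X⟧) :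
    ∃ f ∈ M, ∀ n ∈ Δ, coeff n (h - f) = 0 := by
  have key : ∀ N, ∃ f ∈ M, ∀ n ∈ Δ, n < N → coeff n (h - f) = 0 := by
    intro N
    induction N with
    | zero => exact ⟨0, M.zero_mem, fun n _ hn => absurd hn n.not_lt_zero⟩
    | succ N ih =>
      obtain ⟨f, hf, hfN⟩ := ih
      by_cases hN : N ∈ Δ
      · obtain ⟨g, hg, hg0, hg1⟩ := hM.2.1 N hN
        refine ⟨f + coeff N (h - f) • g, M.add_mem hf (smul_mem_of_mem _ hg), fun n hn hnN => ?_⟩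
        rw [← sub_sub, map_sub, map_smul, smul_eq_mul]
        rcases Nat.lt_succ_iff_lt_or_eq.1 hnN with h1 | rfl
        · rw [hfN n hn h1, hg0 n h1, mul_zero, sub_zero]
        · rw [hg1, mul_one, sub_self]
      · refine ⟨f, hf, fun n hn hnN => hfN n hn ?_⟩
        rcases Nat.lt_succ_iff_lt_or_eq.1 hnN with h1 | rfl
        · exact h1
        · exact absurd hn hN
  -- Finitely many eliminations suffice: from exponent `rk * (p * q)` on, the whole tail lies in `M`
  -- and is subtracted at once. This is where the standardness of `M` enters.
  obtain ⟨f, hf, hfN⟩ := key (rk * (p * q))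
  let g : A⟦X⟧ := PowerSeries.mk fun n => coeff (n + rk * (p * q)) (h - f)
  refine ⟨f + X ^ (rk * (p * q)) * g, M.add_mem hf
    (mem_of_mem_cell hM (fun n hn => mul_mem_semigroup hp hpq hn) g), fun n hn => ?_⟩
  rw [← sub_sub, map_sub, coeff_X_pow_mul']
  split_ifs with hle
  · simp [g, Nat.sub_add_cancel hle]
  · rw [hfN n hn (by omega), sub_zero]

/-- The reduced element of `M` with leading exponent `d`. -/
noncomputable def reduced (Δ : Set ℕ) (M : Submodule (torusRing A rk p q) A⟦X⟧) (d : ℕ) : A⟦X⟧ :=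
  Classical.epsilon fun f => f ∈ M ∧ ∀ n ∈ Δ, coeff n f = if n = d then 1 else 0

theorem reduced_spec (hp : 0 < p) (hpq : p.Coprime q)
    (hM : M ∈ cell A rk p q Δ) (d : ℕ) :
    reduced Δ M d ∈ M ∧ ∀ n ∈ Δ, coeff n (reduced Δ M d) = if n = d then 1 else 0 := by
  obtain ⟨f, hf, h⟩ := exists_sub_forall_coeff hp hpq hM (X ^ d : A⟦X⟧)
  refine Classical.epsilon_spec
    (p := fun f => f ∈ M ∧ ∀ n ∈ Δ, coeff n f = if n = d then 1 else 0) ⟨f, hf, fun n hn => ?_⟩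
  have := h n hn
  rw [map_sub, sub_eq_zero, coeff_X_pow] at this
  exact this.symm

theorem eq_reduced (hp : 0 < p) (hpq : p.Coprime q)
    (hM : M ∈ cell A rk p q Δ) {d : ℕ} {f : A⟦X⟧} (hf : f ∈ M)
    (h : ∀ n ∈ Δ, coeff n f = if n = d then 1 else 0) : f = reduced Δ M d := by
  have hr := reduced_spec hp hpq hM d
  refine sub_eq_zero.1 (eq_zero_of_mem_cell hM (M.sub_mem hf hr.1) fun n hn => ?_)
  rw [map_sub, h n hn, hr.2 n hn, sub_self]

theorem coeff_reduced_of_lt (hp : 0 < p) (hpq : p.Coprime q)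
    (hM : M ∈ cell A rk p q Δ) {d n : ℕ} (hn : n < d) : coeff n (reduced Δ M d) = 0 := by
  have hr := reduced_spec hp hpq hM d
  refine eq_zero_of_forall_coeff (fun e he h0 => hM.2.2 e he _ hr.1 h0) (fun m hm hmd => ?_) n hn
  rw [hr.2 m hm, if_neg hmd.ne]

/-- The coefficients of the reduced generators of `M`. -/
noncomputable def generatorCoeff (Δ : Set ℕ) (M : Submodule (torusRing A rk p q) A⟦X⟧)
    (s : ZMod (rk * p)) (g : ℕ) : A :=
  coeff (classMin rk p Δ s + g) (reduced Δ M (classMin rk p Δ s))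

theorem generatorCoeff_zero (hrk : 0 < rk) (hp : 0 < p) (hpq : p.Coprime q)
    (hΔ : IsStandardSet rk p q Δ) (hM : M ∈ cell A rk p q Δ) (s : ZMod (rk * p)) :
    generatorCoeff Δ M s 0 = 1 := by
  rw [generatorCoeff, add_zero,
    (reduced_spec hp hpq hM _).2 _ (classMin_spec hrk hp hpq hΔ s).1, if_pos rfl]

theorem basisSeries_generatorCoeff_classMin (hrk : 0 < rk) (hp : 0 < p) (hpq : p.Coprime q)
    (hΔ : IsStandardSet rk p q Δ) (hM : M ∈ cell A rk p q Δ) (s : ZMod (rk * p)) :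
    basisSeries (generatorCoeff Δ M) (classMin rk p Δ s) = reduced Δ M (classMin rk p Δ s) := by
  ext n
  rw [coeff_basisSeries, (classMin_spec hrk hp hpq hΔ s).2]
  split_ifs with h
  · rw [generatorCoeff, Nat.add_sub_cancel' h]
  · rw [coeff_reduced_of_lt hp hpq hM (by omega)]

theorem basisSeries_generatorCoeff_mem (hrk : 0 < rk) (hp : 0 < p) (hpq : p.Coprime q)
    (hΔ : IsStandardSet rk p q Δ) (hM : M ∈ cell A rk p q Δ) {d : ℕ} (hd : d ∈ Δ) :
    basisSeries (generatorCoeff Δ M) d ∈ M := by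
  obtain ⟨m, hm⟩ := exists_eq_classMin_add hrk hp hpq hΔ hd
  rw [hm, basisSeries_add_left, basisSeries_generatorCoeff_classMin hrk hp hpq hΔ hM]
  exact X_pow_mul_mem_of_mem ((mem_semigroup_iff _ _ _ _).2 ⟨m, 0, by ring⟩)
    (reduced_spec hp hpq hM _).1

/-- By induction the partial sum below `d` lies in `M`; the remainder starts at order `d` or later,
so at a gap `d` the jump condition annihilates its coefficient, which is the expansion coefficient.
-/
theorem mem_expansionSubmodule_of_mem (hrk : 0 < rk) (hp : 0 < p) (hpq : p.Coprime q)
    (hΔ : IsStandardSet rk p q Δ) (hM : M ∈ cell A rk p q Δ) {f : A⟦X⟧} (hf : f ∈ M) :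
    f ∈ expansionSubmodule (basisSeries (generatorCoeff Δ M)) Δ := by
  have hG := isUnitriangular_basisSeries (generatorCoeff_zero hrk hp hpq hΔ hM)
  set G := basisSeries (generatorCoeff Δ M)
  intro d
  induction d using Nat.strong_induction_on with
  | _ d ih =>
    intro hd
    have hmem : f - ∑ i ∈ Finset.range d, expansionCoeff G i f • G i ∈ M := by
      refine M.sub_mem hf (M.sum_mem fun i hi => ?_)
      by_cases hiΔ : i ∈ Δ
      · exact smul_mem_of_mem _ (basisSeries_generatorCoeff_mem hrk hp hpq hΔ hM hiΔ)
      · rw [ih i (Finset.mem_range.1 hi) hiΔ, zero_smul]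
        exact M.zero_mem
    have h0 : ∀ n < d, coeff n (f - ∑ i ∈ Finset.range d, expansionCoeff G i f • G i) = 0 := by
      intro n hn
      obtain ⟨d, rfl⟩ : ∃ r, d = r + 1 := ⟨d - 1, by omega⟩
      exact coeff_sub_partialSum hG f (Nat.lt_succ_iff.1 hn)
    have := hM.2.2 d hd _ hmem h0
    rw [map_sub, map_sum] at this
    rw [expansionCoeff_apply]
    simpa using this

/-- For the converse, reduce `f` modulo `M` to a series without exponents in `Δ`. It is still in the
expansion submodule, so a leading exponent would have to lie in `Δ`; hence it is zero. -/
theorem mem_iff_mem_expansionSubmodule (hrk : 0 < rk) (hp : 0 < p) (hpq : p.Coprime q)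
    (hΔ : IsStandardSet rk p q Δ) (hM : M ∈ cell A rk p q Δ) {f : A⟦X⟧} :
    f ∈ M ↔ f ∈ expansionSubmodule (basisSeries (generatorCoeff Δ M)) Δ := by
  refine ⟨mem_expansionSubmodule_of_mem hrk hp hpq hΔ hM, fun hf => ?_⟩
  obtain ⟨g, hg, hfg⟩ := exists_sub_forall_coeff hp hpq hM f
  have hsub := Submodule.sub_mem _ hf (mem_expansionSubmodule_of_mem hrk hp hpq hΔ hM hg)
  have : f - g = 0 := by
    ext n
    refine eq_zero_of_forall_coeff (fun d hd h0 => ?_) (N := n + 1) (fun m hm _ => hfg m hm) n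
      n.lt_succ_self
    rw [← expansionCoeff_of_forall_lt (G := basisSeries (generatorCoeff Δ M)) h0]
    exact hsub d hd
  rwa [sub_eq_zero.1 this]

theorem isSyzygy_generatorCoeff (hrk : 0 < rk) (hp : 0 < p) (hpq : p.Coprime q)
    (hΔ : IsStandardSet rk p q Δ) (hM : M ∈ cell A rk p q Δ) :
    IsSyzygy rk p q Δ (generatorCoeff Δ M) fun s g =>
      expansionCoeff (basisSeries (generatorCoeff Δ M)) (classMin rk p Δ s + rk * q + g)
        (X ^ (rk * q) * reduced Δ M (classMin rk p Δ s)) where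
  left_zero := generatorCoeff_zero hrk hp hpq hΔ hM
  left_mem s g hg hd := by
    rw [generatorCoeff, (reduced_spec hp hpq hM _).2 _ hd, if_neg (by omega)]
  right_notMem s g hd := by
    refine mem_expansionSubmodule_of_mem hrk hp hpq hΔ hM ?_ _ hd
    exact X_pow_mul_mem_of_mem ((mem_semigroup_iff _ _ _ _).2 ⟨0, 1, by ring⟩)
      (reduced_spec hp hpq hM _).1
  eq s g := by
    have hG := isUnitriangular_basisSeries (generatorCoeff_zero hrk hp hpq hΔ hM)
    set b := classMin rk p Δ s with hb
    have hbs : (b : ZMod (rk * p)) = s := (classMin_spec hrk hp hpq hΔ s).2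
    have h1 : coeff (b + rk * q + g) (X ^ (rk * q) * reduced Δ M b) = generatorCoeff Δ M s g := by
      rw [coeff_X_pow_mul', if_pos (by omega), generatorCoeff,
        show b + rk * q + g - rk * q = b + g by omega]
    -- The expansion indices below `b + rk * q` contribute nothing, since the multiplied series
    -- starts at that exponent; the rest is the convolution.
    rw [← h1, coeff_eq_sum_expansionCoeff hG, add_assoc (b + rk * q) g 1, Finset.sum_range_add,
      Finset.sum_eq_zero, zero_add]
    · refine Finset.sum_congr rfl fun i hi => ?_
      have hi := Finset.mem_range.1 hi
      rw [coeff_basisSeries, if_pos (by omega),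
        show b + rk * q + g - (b + rk * q + i) = g - i by omega]
      push_cast
      rw [hbs]
    · intro i hi
      have hi := Finset.mem_range.1 hi
      rw [expansionCoeff_eq_zero_of_coeff, zero_mul]
      intro n hn
      rw [coeff_X_pow_mul']
      split_ifs with h
      · exact coeff_reduced_of_lt hp hpq hM (by omega)
      · rfl

/-- The series built from `l` satisfy the conditions that characterise reduced elements, so
uniqueness identifies the two. -/
theorem generatorCoeff_toSubmodule (hrk : 0 < rk) (hp : 0 < p) (hpq : p.Coprime q)
    (hΔ : IsStandardSet rk p q Δ) {l m : ZMod (rk * p) → ℕ → A} (h : IsSyzygy rk p q Δ l m)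
    (s : ZMod (rk * p)) (g : ℕ) :
    generatorCoeff Δ (h.toSubmodule hrk hp hpq hΔ) s g = l s g := by
  have hb := classMin_spec hrk hp hpq hΔ s
  have hG := isUnitriangular_basisSeries h.left_zero
  rw [generatorCoeff, ← eq_reduced hp hpq (h.toSubmodule_mem_cell hrk hp hpq hΔ)
    (f := basisSeries l (classMin rk p Δ s)) (self_mem_expansionSubmodule hG hb.1),
    coeff_basisSeries, if_pos (Nat.le_add_right _ _), hb.2, Nat.add_sub_cancel_left]
  intro n hn
  rw [coeff_basisSeries, hb.2]
  split_ifs with h1 h2 h2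
  · rw [h2, Nat.sub_self, h.left_zero]
  · exact h.left_mem s _ (by omega) (by rwa [Nat.add_sub_cancel' h1])
  · omega
  · rfl

/-- The points of the cell correspond to the values of their free coefficients. -/
theorem bijective_freeCoeff (hrk : 0 < rk) (hp : 0 < p) (hpq : p.Coprime q)
    (hΔ : IsStandardSet rk p q Δ) :
    Function.Bijective fun (M : cell A rk p q Δ) (x : freeSet rk p q Δ) =>
      generatorCoeff Δ M.1 x.1.1 x.1.2 := by
  classical
  constructor
  · rintro ⟨M, hM⟩ ⟨M', hM'⟩ h
    have hl := (isSyzygy_generatorCoeff hrk hp hpq hΔ hM).ext hrk hp hpq hΔ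
      (isSyzygy_generatorCoeff hrk hp hpq hΔ hM') fun x hx => congrFun h ⟨x, hx⟩
    refine Subtype.ext (Submodule.ext fun f => ?_)
    rw [mem_iff_mem_expansionSubmodule hrk hp hpq hΔ hM,
      mem_iff_mem_expansionSubmodule hrk hp hpq hΔ hM', hl]
  · intro v
    obtain ⟨l, m, h, hv⟩ := exists_isSyzygy hrk hp hpq hΔ
      (fun s g => if hx : (s, g) ∈ freeSet rk p q Δ then v ⟨(s, g), hx⟩ else 0)
      fun s g hx => dif_neg hx
    refine ⟨⟨_, h.toSubmodule_mem_cell hrk hp hpq hΔ⟩, funext fun x => ?_⟩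
    simp only [generatorCoeff_toSubmodule hrk hp hpq hΔ h, hv x.1 x.2]
    exact dif_pos x.2

end Reduced

/-! ### Compatibility with base change -/

section BaseChange

variable {A B : Type u} [CommRing A] [CommRing B] {rk p q : ℕ} {Δ : Set ℕ}
  {M : Submodule (torusRing A rk p q) A⟦X⟧}

theorem map_mem_baseChange (φ : A →+* B) {f : A⟦X⟧} (hf : f ∈ M) :
    PowerSeries.map φ f ∈ baseChange φ M :=
  Submodule.subset_span ⟨f, hf, rfl⟩

theorem baseChange_mem_cell (hrk : 0 < rk) (hp : 0 < p) (hpq : p.Coprime q)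
    (hΔ : IsStandardSet rk p q Δ) (φ : A →+* B) (hM : M ∈ cell A rk p q Δ) :
    baseChange φ M ∈ cell B rk p q Δ := by
  have hjump : ∀ d ∈ Δ, ∃ f ∈ baseChange φ M, (∀ n < d, coeff n f = 0) ∧ coeff d f = 1 := by
    intro d hd
    obtain ⟨f, hf, h0, h1⟩ := hM.2.1 d hd
    exact ⟨_, map_mem_baseChange φ hf, fun n hn => by rw [coeff_map, h0 n hn, map_zero],
      by rw [coeff_map, h1, map_one]⟩
  refine ⟨isStandard_of_jumps hrk fun i hi => hjump i (hΔ.lt_mem i hi), hjump, ?_⟩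
  have h := (isSyzygy_generatorCoeff hrk hp hpq hΔ hM).map φ
  -- The jumps at `Δ` pass to images, but the span could acquire new leading terms at gaps.
  -- Containment in the point of the cell defined by the image syzygy excludes this.
  have hle : baseChange φ M ≤ h.toSubmodule hrk hp hpq hΔ := by
    refine Submodule.span_le.2 ?_
    rintro _ ⟨f, hf, rfl⟩ d hd
    have h1 := mem_expansionSubmodule_of_mem hrk hp hpq hΔ hM hf d hd
    have h2 := expansionCoeff_map φ (basisSeries (generatorCoeff Δ M)) f d
    simp only [map_basisSeries] at h2
    rw [h1, map_zero] at h2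
    exact h2
  exact fun d hd f hf h0 => (h.toSubmodule_mem_cell hrk hp hpq hΔ).2.2 d hd f (hle hf) h0

theorem generatorCoeff_baseChange (hrk : 0 < rk) (hp : 0 < p) (hpq : p.Coprime q)
    (hΔ : IsStandardSet rk p q Δ) (φ : A →+* B) (hM : M ∈ cell A rk p q Δ)
    (s : ZMod (rk * p)) (g : ℕ) :
    generatorCoeff Δ (baseChange φ M) s g = φ (generatorCoeff Δ M s g) := by
  have hr := reduced_spec hp hpq hM (classMin rk p Δ s)
  rw [generatorCoeff, ← eq_reduced hp hpq (baseChange_mem_cell hrk hp hpq hΔ φ hM)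
    (map_mem_baseChange φ hr.1), coeff_map, generatorCoeff]
  intro n hn
  rw [coeff_map, hr.2 n hn]
  split_ifs <;> simp

end BaseChange

end TorusCell

namespace TorusCell

/-! ### Counting the free coefficients -/

section Count

variable {rk p q : ℕ} {Δ : Set ℕ}

theorem finite_gaps (hrk : 0 < rk) (hp : 0 < p) (hpq : p.Coprime q)
    (hΔ : IsStandardSet rk p q Δ) : Δᶜ.Finite :=
  (Set.finite_lt_nat (rk * (p * q))).subset fun _ hn =>
    not_le.1 fun h => hn (hΔ.mem_of_le hrk hp hpq h)

theorem gapCount_eq_ncard (Δ : Set ℕ) (b : ℕ) : gapCount Δ b = {g | b + g ∉ Δ}.ncard := by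
  rw [gapCount, ← Set.ncard_image_of_injective {g | b + g ∉ Δ} (add_right_injective b)]
  congr 1
  ext n
  constructor
  · rintro ⟨hn, hd⟩
    exact ⟨n - b, by simpa [Nat.add_sub_cancel' hn] using hd, Nat.add_sub_cancel' hn⟩
  · rintro ⟨g, hg, rfl⟩
    exact ⟨Nat.le_add_right _ _, hg⟩

/-- The number of gaps `n ≥ b` with `n + rk * q ∈ Δ`. -/
theorem ncard_add_mem (hrk : 0 < rk) (hp : 0 < p) (hpq : p.Coprime q)
    (hΔ : IsStandardSet rk p q Δ) (b : ℕ) :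
    ({g | b + g ∉ Δ ∧ b + rk * q + g ∈ Δ}.ncard : ℤ) =
      gapCount Δ b - gapCount Δ (b + rk * q) := by
  have hfin := finite_gaps hrk hp hpq hΔ
  have hsub : {g | b + rk * q + g ∉ Δ} ⊆ {g | b + g ∉ Δ} := by
    intro g hg hd
    apply hg
    convert hΔ.add_right_mem hd using 1
    ring
  have h3 : {g | b + g ∉ Δ ∧ b + rk * q + g ∈ Δ} =
      {g | b + g ∉ Δ} \ {g | b + rk * q + g ∉ Δ} := by
    ext g
    simp
  have hfin1 : {g | b + g ∉ Δ}.Finite := hfin.preimage (add_right_injective b).injOn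
  rw [gapCount_eq_ncard, gapCount_eq_ncard, h3, ← Set.ncard_sdiff_add_ncard_of_subset hsub hfin1]
  push_cast
  ring

theorem finite_freeSet (hrk : 0 < rk) (hp : 0 < p) (hpq : p.Coprime q)
    (hΔ : IsStandardSet rk p q Δ) : (freeSet rk p q Δ).Finite := by
  have : NeZero (rk * p) := ⟨(Nat.mul_pos hrk hp).ne'⟩
  refine (Set.finite_univ.prod (Set.finite_lt_nat (rk * (p * q)))).subset ?_
  rintro ⟨s, g⟩ hx
  exact ⟨trivial, not_le.1 fun h => hx.1
    (hΔ.mem_of_le hrk hp hpq (le_trans h (Nat.le_add_left _ _)))⟩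

theorem card_freeSet (hrk : 0 < rk) (hp : 0 < p) (hpq : p.Coprime q)
    (hΔ : IsStandardSet rk p q Δ) [Fintype (ZMod (rk * p))] :
    (Nat.card (freeSet rk p q Δ) : ℤ) = ∑ s : ZMod (rk * p),
      ((gapCount Δ (classMin rk p Δ s) : ℤ) - gapCount Δ (classMin rk p Δ s + rk * q)) := by
  let e : freeSet rk p q Δ ≃ Σ s : ZMod (rk * p),
      {g | classMin rk p Δ s + g ∉ Δ ∧ classMin rk p Δ s + rk * q + g ∈ Δ} :=
    { toFun := fun x => ⟨x.1.1, x.1.2, x.2⟩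
      invFun := fun x => ⟨(x.1, x.2.1), x.2.2⟩
      left_inv := fun _ => rfl
      right_inv := fun _ => rfl }
  have hfin : ∀ s : ZMod (rk * p), Finite
      {g | classMin rk p Δ s + g ∉ Δ ∧ classMin rk p Δ s + rk * q + g ∈ Δ} := fun s =>
    (((finite_gaps hrk hp hpq hΔ).preimage
      (add_right_injective (classMin rk p Δ s)).injOn).subset fun g hg => hg.1).to_subtype
  rw [Nat.card_congr e, Nat.card_sigma, Nat.cast_sum]
  exact Finset.sum_congr rfl fun s _ => ncard_add_mem hrk hp hpq hΔ _

/-- The least elements of the residue classes modulo `rk * p` are given by the `p`-bases. -/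
theorem classMin_pBasis (hrk : 0 < rk) (hp : 0 < p) (hpq : p.Coprime q)
    (hΔ : IsStandardSet rk p q Δ) {i : ℕ} (hi : i < rk) (j : ℕ) :
    classMin rk p Δ ((rk * pBasis rk p q Δ i j + i : ℕ) : ZMod (rk * p)) =
      rk * pBasis rk p q Δ i j + i := by
  obtain ⟨hmem, hmod⟩ := pBasis_mem hΔ hi j
  refine le_antisymm (classMin_le hmem) ?_
  obtain ⟨h1, h2⟩ := classMin_spec hrk hp hpq hΔ
    ((rk * pBasis rk p q Δ i j + i : ℕ) : ZMod (rk * p))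
  set x := classMin rk p Δ ((rk * pBasis rk p q Δ i j + i : ℕ) : ZMod (rk * p))
  rw [ZMod.natCast_eq_natCast_iff] at h2
  have hx : x % rk = i := by
    have h3 : x % rk = _ % rk := h2.of_mul_right p
    rwa [Nat.mul_add_mod, Nat.mod_eq_of_lt hi] at h3
  -- The least element `x` of the class has remainder `i` mod `rk`, so its quotient by `rk` competes
  -- in the minimum defining `pBasis`.
  have hdiv : rk * (x / rk) + i = x := by rw [← hx, Nat.div_add_mod]
  rw [← hdiv] at h1 h2 ⊢
  have h4 := Nat.ModEq.mul_left_cancel' hrk.ne' (Nat.ModEq.add_right_cancel' i h2)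
  have h5 : pBasis rk p q Δ i j ≤ x / rk := Nat.sInf_le ⟨h1, h4.trans hmod⟩
  exact Nat.add_le_add_right (Nat.mul_le_mul_left rk h5) i

theorem sum_exponent_eq (hrk : 0 < rk) (hp : 0 < p) (hpq : p.Coprime q)
    (hΔ : IsStandardSet rk p q Δ) :
    (Nat.card (freeSet rk p q Δ) : ℤ) = ∑ i ∈ Finset.range rk, exponent rk p q Δ i := by
  have : NeZero (rk * p) := ⟨(Nat.mul_pos hrk hp).ne'⟩
  rw [card_freeSet hrk hp hpq hΔ]
  let c : Fin rk × Fin p → ZMod (rk * p) := fun x =>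
    ((rk * pBasis rk p q Δ x.1 x.2 + x.1 : ℕ) : ZMod (rk * p))
  have hinj : Function.Injective c := by
    rintro ⟨i, j⟩ ⟨i', j'⟩ h
    have h1 : rk * pBasis rk p q Δ i j + i = rk * pBasis rk p q Δ i' j' + i' := by
      rw [← classMin_pBasis hrk hp hpq hΔ i.2 j, ← classMin_pBasis hrk hp hpq hΔ i'.2 j']
      exact congrArg _ h
    have hi : (i : ℕ) = i' := by
      have := congrArg (· % rk) h1
      simpa [Nat.mul_add_mod, Nat.mod_eq_of_lt i.2, Nat.mod_eq_of_lt i'.2] using this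
    have hii := Fin.ext hi
    subst hii
    have h2 := Nat.eq_of_mul_eq_mul_left hrk (Nat.add_right_cancel h1)
    have h3 : (j : ℕ) * q ≡ j' * q [MOD p] := by
      have h4 := pBasis_modEq hΔ i.2 j
      rw [h2] at h4
      exact h4.symm.trans (pBasis_modEq hΔ i.2 j')
    have h5 := Nat.ModEq.cancel_right_of_coprime hpq h3
    have hj : j = j' := Fin.ext (h5.eq_of_lt_of_lt j.2 j'.2)
    rw [hj]
  -- The class determines `i` mod `rk`, then `j * q` mod `p`, hence `j` by coprimality; both sides
  -- have `rk * p` elements.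
  have hbij : Function.Bijective c :=
    (Fintype.bijective_iff_injective_and_card c).2 ⟨hinj, by simp [ZMod.card]⟩
  rw [← hbij.sum_comp, Fintype.sum_prod_type, ← Fin.sum_univ_eq_sum_range]
  refine Finset.sum_congr rfl fun i _ => ?_
  rw [exponent, ← Fin.sum_univ_eq_sum_range fun j =>
    ((gapCount Δ (rk * pBasis rk p q Δ i j + i) : ℤ)
      - (gapCount Δ (rk * pBasis rk p q Δ i j + i + rk * q) : ℤ))]
  refine Finset.sum_congr rfl fun j _ => ?_
  simp only [c, classMin_pBasis hrk hp hpq hΔ i.2 j]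

end Count

end TorusCell

theorem mainTheorem1 (k : Type u) [Field k] (rk p q : ℕ) (hrk : 0 < rk) (hp : 0 < p) (hq : 0 < q)
    (hpq : p.Coprime q) (Δ : Set ℕ) (hΔ : TorusCell.IsStandardSet rk p q Δ) :
    ∃ N : ℕ, (N : ℤ) = ∑ i ∈ Finset.range rk, TorusCell.exponent rk p q Δ i ∧
      ∃ Φ : ∀ (A : Type u) [CommRing A] [Algebra k A],
          TorusCell.cell A rk p q Δ ≃ (Fin N → A),
        ∀ (A B : Type u) [CommRing A] [Algebra k A] [CommRing B] [Algebra k B] (φ : A →ₐ[k] B)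
          (M : TorusCell.cell A rk p q Δ),
          ∃ hM : TorusCell.baseChange (φ : A →+* B) M.1 ∈ TorusCell.cell B rk p q Δ,
            ∀ n : Fin N, Φ B ⟨_, hM⟩ n = φ (Φ A M n) := by
  have := (TorusCell.finite_freeSet hrk hp hpq hΔ).to_subtype
  let e : TorusCell.freeSet rk p q Δ ≃ Fin (Nat.card (TorusCell.freeSet rk p q Δ)) :=
    Finite.equivFin _
  refine ⟨_, TorusCell.sum_exponent_eq hrk hp hpq hΔ, fun A _ _ =>
    (Equiv.ofBijective _ (TorusCell.bijective_freeCoeff (A := A) hrk hp hpq hΔ)).trans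
      (Equiv.arrowCongr e (Equiv.refl A)), ?_⟩
  intro A B _ _ _ _ φ M
  exact ⟨TorusCell.baseChange_mem_cell hrk hp hpq hΔ _ M.2, fun n =>
    TorusCell.generatorCoeff_baseChange hrk hp hpq hΔ (φ : A →+* B) M.2 _ _⟩
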